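/- For $f\in L^1(\mathbb{R})\cap L^2(\mathbb{R})$ (complex-valued) write $\hat f(\xi)=\int_{\mathbb{R}} f(x)e^{-2\pi i x\xi}\,dx$, and let \[ \mathcal{H}=\Bigl\{f\in L^2(\mathbb{R}) : \int_{\mathbb{R}}(1+x^2)|f(x)|^2\,dx+\int_{\mathbb{R}}(1+\xi^2)|\hat f(\xi)|^2\,d\xi<\infty\Bigr\}, \] where each element of $\mathcal{H}$ is identified with its continuous representative. A pair $(\Lambda,M)$ of subsets of $\mathbb{R}$ is a uniqueness pair for $\mathcal{H}$ if the only $f\in\mathcal{H}$ with $f|_\Lambda=0$ and $\hat f|_M=0$ is $f\equiv 0$. Call a pair of sequences $\Lambda=(\lambda_j)_{j\in\mathbb{Z}}$, $M=(\mu_j)_{j\in\mathbb{Z}}$ of real numbers ordered if both are strictly increasing and $\lim_{j\to\pm\infty}\lambda_j=\pm\infty$, $\lim_{j\to\pm\infty}\mu_j=\pm\infty$. Let $1<p,q<\infty$ with $\frac1p+\frac1q=1$. Then there exist constants $d_p,d_q\ge 0$ such that the following two assertions hold. (i) Every ordered pair $(\Lambda,M)$ with \[ \sup_{j\in\mathbb{Z}}\,(|\lambda_j|+d_p)^{p-1}(\lambda_{j+1}-\lambda_j)\le\tfrac12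 \quad\text{and}\quad \sup_{j\in\mathbb{Z}}\,(|\mu_j|+d_q)^{q-1}(\mu_{j+1}-\mu_j)\le\tfrac12 \] is a uniqueness pair for $\mathcal{H}$. (ii) There is an ordered pair $(\Lambda,M)$ satisfying the two bounds in (i) which has critical density, that is, \[ \lim_{|j|\to\infty}|\lambda_j|^{p-1}(\lambda_{j+1}-\lambda_j)=\tfrac12 \quad\text{and}\quad \lim_{|j|\to\infty}|\mu_j|^{q-1}(\mu_{j+1}-\mu_j)=\tfrac12 . \] By (i) it is a uniqueness pair for $\mathcal{H}$; so critical uniqueness pairs exist for all conjugate $p,q$, in particular for $p,q\neq 2$. -/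

import Mathlib

open Filter Topology MeasureTheory
open scoped FourierTransform

namespace FourierUniqueness

/-- The Fourier symmetric Sobolev space `𝓗` of all `f ∈ L²(ℝ)` with
`∫ (1 + x²) |f(x)|² dx + ∫ (1 + ξ²) |f̂(ξ)|² dξ < ∞`. Every class in this space has exactly one
continuous representative, and the space is given here as the set of these representatives, so
that point values make sense. Here `𝓕 f ξ = ∫ f(x) exp(-2πixξ) dx`. -/
def symSobolev : Set (ℝ → ℂ) :=
  {f | Continuous f ∧ MemLp f 2 volume ∧
    Integrable (fun x : ℝ => (1 + x ^ 2) * ‖f x‖ ^ 2) ∧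
    Integrable (fun ξ : ℝ => (1 + ξ ^ 2) * ‖𝓕 f ξ‖ ^ 2)}

/-- The functions in `symSobolev` are integrable, so their Fourier integrals converge. -/
theorem integrable_of_mem_symSobolev {f : ℝ → ℂ} (hf : f ∈ symSobolev) :
    Integrable f := by
  obtain ⟨hc, -, h1, -⟩ := hf
  refine (h1.add integrable_inv_one_add_sq).mono' hc.aestronglyMeasurable
    (Eventually.of_forall fun x => ?_)
  have hw : (0 : ℝ) < 1 + x ^ 2 := by positivity
  have h0 : 0 ≤ ‖f x‖ := norm_nonneg _
  have key : (1 + x ^ 2) * ‖f x‖ ^ 2 + (1 + x ^ 2)⁻¹ - ‖f x‖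
      = (1 + x ^ 2) * (‖f x‖ - (1 + x ^ 2)⁻¹) ^ 2 + ‖f x‖ := by
    field_simp
    ring
  have : 0 ≤ (1 + x ^ 2) * (‖f x‖ - (1 + x ^ 2)⁻¹) ^ 2 + ‖f x‖ := by positivity
  simp only [Pi.add_apply]
  linarith

/-- `(Λ, M)` is a Fourier uniqueness pair for the function space `X`: the only `f ∈ X` with
`f = 0` on `Λ` and `f̂ = 0` on `M` is `f = 0`. -/
def IsUniquenessPair (X : Set (ℝ → ℂ)) (Λ M : Set ℝ) : Prop :=
  ∀ f ∈ X, (∀ x ∈ Λ, f x = 0) → (∀ ξ ∈ M, 𝓕 f ξ = 0) → ∀ x, f x = 0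

/-- A strictly increasing bi-infinite sequence of reals with `lim_{j → ±∞} s_j = ±∞`. -/
def IsOrderedSeq (s : ℤ → ℝ) : Prop :=
  StrictMono s ∧ Tendsto s atTop atTop ∧ Tendsto s atBot atBot

/-- `sup_j (|s_j| + d)^(r-1) (s_{j+1} - s_j) ≤ 1/2`. -/
def UniformGapBound (r d : ℝ) (s : ℤ → ℝ) : Prop :=
  ∀ j : ℤ, (|s j| + d) ^ (r - 1) * (s (j + 1) - s j) ≤ 1 / 2

/-- `|s_j|^(r-1) (s_{j+1} - s_j) → 1/2` as `|j| → ∞`: the upper and lower limits over `j ∈ ℤ`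
both equal the critical value `1/2`. -/
def HasCriticalDensity (r : ℝ) (s : ℤ → ℝ) : Prop :=
  Tendsto (fun j : ℤ => |s j| ^ (r - 1) * (s (j + 1) - s j)) cofinite (𝓝 (1 / 2))

end FourierUniqueness

/-!
Let `r = p - 1`, so that `q - 1 = 1 / r`; as the argument is symmetric in the two sides, `r ≤ 1` may
be assumed. Wirtinger's inequality, summed over the gaps of a zero set and combined with
Plancherel's theorem, says that a function `u` vanishing on a set whose gaps at `y` have length at
most `1 / (2 w(y))` satisfies `∫ w² |u|² ≤ ∫ ξ² |û|²` (`wirtinger_fourier`). For zeros of `f̂` with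
gaps of order `1 / r` this gives
`∫ (|ξ| + C)^(2/r) |f̂|² ≤ ∫ x² |f|²`, and in phase space it pushes `f` into `|ξ|^(1/r) < |x|`. The
zeros of `f` with gaps of order `r` push `f` into the complement `|x|^r < |ξ|`. The two estimates
are made to contradict each other by means of the short-time Fourier transform
`V(x, ξ) = (f φ(· - x))^(ξ)`, where the window `φ` is smooth, supported in `[-1, 1]` and of unit
`L²` norm.

All the functions `f φ(· - x)` vanish on the zero set of `f`. Wirtinger's inequality for them,
integrated in `x` with the weight `(|x| + 2)^(2(1-r))`, bounds `∫ (|y| + 3)² |f|²` by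
`∫∫ (|x| + 2)^(2(1-r)) ξ² |V|²` (`energy_le_lintegral_gabor`). Here the shift `D = 3^(1/r)` in the
gap condition pays for the smearing by the window, through
`(|y| + D)^r (|y| + 1)^(1-r) ≥ |y| + 3` (`shift_le_geom_mean`). Since `|V|²` is a nonnegative density
on phase space, Young's inequality may be applied pointwise to the symbol, which is at most
`(1 - r) (|x| + 2)² + r |ξ|^(2/r)` (`young_symbol`). By Plancherel's theorem in `ξ` and in `x`, the
two terms integrate to at most `(1 - r) ∫ (|y| + 3)² |f|²` and `r ∫ (|ξ| + C)^(2/r) |f̂|²`, the latter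
by Minkowski's inequality with `C` depending on a moment of `φ̂`. Altogether
`∫ (|y| + 3)² |f|² ≤ (1 - r) ∫ (|y| + 3)² |f|² + r ∫ y² |f|²`, whence `f = 0`
(`exists_shift_energy`).

A critical pair arises from the recursion `a_{n+1} = a_n + (a_n + d + 1)^(-r) / 2`, `a_0 = 0`,
extended to an odd sequence (`criticalInt`); the additional shift by `1` makes the gap bound hold
at both endpoints of each gap, as is needed after the reflection.
-/

open Filter Topology MeasureTheory
open scoped FourierTransform

namespace FourierUniqueness

/-! ### Plancherel's theorem on `L¹ ∩ L²` -/

/-- On `L¹ ∩ L²` the Fourier integral represents the `L²` Fourier transform. Both sides define the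
same tempered distribution, so they agree almost everywhere. -/
theorem coeFn_fourier_toLp {h : ℝ → ℂ} (h1 : Integrable h) (h2 : MemLp h 2) :
    (𝓕 (h2.toLp h) : Lp ℂ 2 (volume : Measure ℝ)) =ᵐ[volume] 𝓕 h := by
  have hcont : Continuous (𝓕 h) :=
    VectorFourier.fourierIntegral_continuous Real.continuous_fourierChar
      (L := innerₗ ℝ) (by exact continuous_inner) h1
  refine ae_eq_of_integral_contDiff_smul_eq ?_ hcont.locallyIntegrable ?_
  · exact (Lp.memLp _).locallyIntegrable (by norm_num)
  intro g hg hgc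
  have hgc' : HasCompactSupport (fun x => (g x : ℂ)) :=
    hgc.comp_left (g := fun t : ℝ => (t : ℂ)) (by simp)
  let G : SchwartzMap ℝ ℂ := hgc'.toSchwartzMap (Complex.ofRealCLM.contDiff.comp hg)
  have hG : ∀ x, G x = (g x : ℂ) := fun x => rfl
  have key := congrArg (fun T : TemperedDistribution ℝ ℂ => T G)
    (Lp.fourier_toTemperedDistribution_eq (h2.toLp h))
  simp only [TemperedDistribution.fourier_apply, Lp.toTemperedDistribution_apply] at key
  have e1 : ∫ x, g x • (𝓕 (h2.toLp h) : Lp ℂ 2 (volume : Measure ℝ)) x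
      = ∫ x, G x • (𝓕 (h2.toLp h) : Lp ℂ 2 (volume : Measure ℝ)) x := by
    refine integral_congr_ae (Eventually.of_forall fun x => ?_)
    simp [hG]
  rw [e1, ← key]
  have e2 : ∫ x, (𝓕 G) x • (h2.toLp h) x = ∫ x, (𝓕 G) x • h x := by
    refine integral_congr_ae ?_
    filter_upwards [h2.coeFn_toLp] with x hx
    rw [hx]
  rw [e2, SchwartzMap.fourier_coe]
  have e3 := VectorFourier.integral_fourierIntegral_smul_eq_flip (L := innerₗ ℝ)
    (μ := volume) (ν := volume) (f := (G : ℝ → ℂ)) (g := h)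
    Real.continuous_fourierChar (by exact continuous_inner) G.integrable h1
  rw [flip_innerₗ] at e3
  refine Eq.trans e3 (integral_congr_ae (Eventually.of_forall fun x => ?_))
  simp only [hG]
  rfl

/-- Plancherel's theorem for the Fourier integral on `L¹ ∩ L²`. -/
theorem lintegral_enorm_fourier_sq {h : ℝ → ℂ} (h1 : Integrable h) (h2 : MemLp h 2) :
    ∫⁻ ξ, ‖𝓕 h ξ‖ₑ ^ 2 = ∫⁻ x, ‖h x‖ₑ ^ 2 := by
  have hn : eLpNorm (𝓕 h) 2 volume = eLpNorm h 2 volume := by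
    rw [← eLpNorm_congr_ae (coeFn_fourier_toLp h1 h2), ← eLpNorm_congr_ae h2.coeFn_toLp,
      ← Lp.enorm_def, ← Lp.enorm_def]
    exact enorm_eq_iff_norm_eq.2 (Lp.norm_fourier_eq _)
  have e (g : ℝ → ℂ) : eLpNorm g 2 volume ^ ((2 : NNReal) : ℝ) = _ :=
    eLpNorm_nnreal_pow_eq_lintegral two_ne_zero
  have hpow := (e (𝓕 h)).symm.trans ((congrArg (· ^ ((2 : NNReal) : ℝ)) hn).trans (e h))
  simpa using hpow

/-! ### Wirtinger's inequality on a bounded interval -/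

/-- Wirtinger's inequality with a subcritical constant `k < π / (b - a)`. With
`T y = k tan (k (y - m))`, `m` the midpoint, `‖u'‖² - k² ‖u‖²` differs from the square
`‖u' + T u‖²` by the derivative of `T ‖u‖²`, which integrates to zero. -/
theorem sq_mul_integral_norm_sq_le {u u' : ℝ → ℂ} {a b k : ℝ} (hab : a < b)
    (hk0 : 0 ≤ k) (hk : k * (b - a) < Real.pi) (hu : ∀ y, HasDerivAt u (u' y) y)
    (hu' : Continuous u') (ha : u a = 0) (hb : u b = 0) :
    k ^ 2 * ∫ y in a..b, ‖u y‖ ^ 2 ≤ ∫ y in a..b, ‖u' y‖ ^ 2 := by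
  set m : ℝ := (a + b) / 2 with hm
  set T : ℝ → ℝ := fun y => k * Real.tan (k * (y - m)) with hT
  have huc : Continuous u := continuous_iff_continuousAt.2 fun y => (hu y).continuousAt
  have hcos : ∀ y ∈ Set.uIcc a b, Real.cos (k * (y - m)) ≠ 0 := by
    intro y hy
    rw [Set.uIcc_of_le hab.le] at hy
    refine (Real.cos_pos_of_mem_Ioo ⟨?_, ?_⟩).ne'
    · nlinarith [hy.1, hy.2]
    · nlinarith [hy.1, hy.2]
  have hTd : ∀ y ∈ Set.uIcc a b, HasDerivAt T (k ^ 2 + T y ^ 2) y := by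
    intro y hy
    have h1 : HasDerivAt (fun y => k * (y - m)) k y := by
      simpa using ((hasDerivAt_id y).sub_const m).const_mul k
    have h2 := ((Real.hasDerivAt_tan (hcos y hy)).comp y h1).const_mul k
    refine h2.congr_deriv ?_
    have h3 := Real.inv_one_add_tan_sq (hcos y hy)
    rw [one_div, ← h3, inv_inv]
    simp only [hT]
    ring
  have hTc : ContinuousOn T (Set.uIcc a b) := fun y hy =>
    (hTd y hy).continuousAt.continuousWithinAt
  have hF : ∀ y ∈ Set.uIcc a b, HasDerivAt (fun y => ‖u y‖ ^ 2 * T y)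
      (2 * inner ℝ (u y) (u' y) * T y + ‖u y‖ ^ 2 * (k ^ 2 + T y ^ 2)) y :=
    fun y hy => (hu y).norm_sq.mul (hTd y hy)
  have hFc : ContinuousOn (fun y => 2 * inner ℝ (u y) (u' y) * T y
      + ‖u y‖ ^ 2 * (k ^ 2 + T y ^ 2)) (Set.uIcc a b) := by
    have h1 : Continuous fun y => inner ℝ (u y) (u' y) := huc.inner hu'
    have h2 : Continuous fun y => ‖u y‖ ^ 2 := huc.norm.pow 2
    exact ((continuousOn_const.mul h1.continuousOn).mul hTc).add
      (h2.continuousOn.mul (continuousOn_const.add (hTc.pow 2)))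
  have hFint := intervalIntegral.integral_eq_sub_of_hasDerivAt hF hFc.intervalIntegrable
  simp only [ha, hb, norm_zero] at hFint
  have i1 : IntervalIntegrable (fun y => ‖u y‖ ^ 2) volume a b :=
    (huc.norm.pow 2).intervalIntegrable _ _
  have i2 : IntervalIntegrable (fun y => ‖u' y‖ ^ 2) volume a b :=
    (hu'.norm.pow 2).intervalIntegrable _ _
  have hnn : 0 ≤ ∫ y in a..b, ((‖u' y‖ ^ 2 - k ^ 2 * ‖u y‖ ^ 2)
      + (2 * inner ℝ (u y) (u' y) * T y + ‖u y‖ ^ 2 * (k ^ 2 + T y ^ 2))) := by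
    refine intervalIntegral.integral_nonneg hab.le fun y _ => ?_
    have h1 : ‖u' y + T y • u y‖ ^ 2
        = ‖u' y‖ ^ 2 + 2 * (T y * inner ℝ (u y) (u' y)) + (T y * ‖u y‖) ^ 2 := by
      rw [norm_add_sq_real, real_inner_smul_right, real_inner_comm, norm_smul, mul_pow, mul_pow,
        Real.norm_eq_abs, sq_abs]
    have h2 : 0 ≤ ‖u' y + T y • u y‖ ^ 2 := by positivity
    rw [h1] at h2
    linarith
  rw [intervalIntegral.integral_add (i2.sub (i1.const_mul _)) hFc.intervalIntegrable, hFint,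
    intervalIntegral.integral_sub i2 (i1.const_mul _), intervalIntegral.integral_const_mul] at hnn
  linarith

/-- Wirtinger's inequality with the sharp constant `π / (b - a)`. -/
theorem wirtinger_interval {u u' : ℝ → ℂ} {a b : ℝ} (hab : a < b)
    (hu : ∀ y, HasDerivAt u (u' y) y) (hu' : Continuous u') (ha : u a = 0) (hb : u b = 0) :
    (Real.pi / (b - a)) ^ 2 * ∫ y in a..b, ‖u y‖ ^ 2 ≤ ∫ y in a..b, ‖u' y‖ ^ 2 := by
  have hL : 0 < b - a := sub_pos.2 hab
  have hlim : Tendsto (fun k : ℝ => k ^ 2 * ∫ y in a..b, ‖u y‖ ^ 2)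
      (𝓝[<] (Real.pi / (b - a))) (𝓝 ((Real.pi / (b - a)) ^ 2 * ∫ y in a..b, ‖u y‖ ^ 2)) :=
    Tendsto.mono_left (Continuous.tendsto (by fun_prop) _) nhdsWithin_le_nhds
  refine le_of_tendsto hlim ?_
  filter_upwards [Ioo_mem_nhdsLT (div_pos Real.pi_pos hL)] with k hk
  exact sq_mul_integral_norm_sq_le hab hk.1.le ((lt_div_iff₀ hL).1 hk.2) hu hu' ha hb

/-- Wirtinger's inequality for the difference of a function and its linear interpolation. The
subtraction does not increase the right-hand side, since the slope is the mean of `u'`. -/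
theorem wirtinger_sub_interpolation {u u' : ℝ → ℂ} {a b : ℝ} (hab : a < b)
    (hu : ∀ y, HasDerivAt u (u' y) y) (hu' : Continuous u') :
    (Real.pi / (b - a)) ^ 2 *
      ∫ y in a..b, ‖u y - (u a + ((y - a) / (b - a)) • (u b - u a))‖ ^ 2
        ≤ ∫ y in a..b, ‖u' y‖ ^ 2 := by
  have hL : 0 < b - a := sub_pos.2 hab
  set s : ℂ := (b - a)⁻¹ • (u b - u a) with hs
  have hd : ∀ y, HasDerivAt (fun y => u y - (u a + ((y - a) / (b - a)) • (u b - u a)))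
      (u' y - s) y := by
    intro y
    refine (hu y).sub (HasDerivAt.const_add _ ?_)
    have h1 : HasDerivAt (fun y : ℝ => (y - a) / (b - a)) (b - a)⁻¹ y := by
      simpa [one_div] using ((hasDerivAt_id y).sub_const a).div_const (b - a)
    exact h1.smul_const _
  have h := wirtinger_interval hab hd (hu'.sub continuous_const) (by simp)
    (by simp [div_self hL.ne'])
  refine h.trans ?_
  have hint : ∫ y in a..b, u' y = (b - a) • s := by
    rw [intervalIntegral.integral_eq_sub_of_hasDerivAt (fun y _ => hu y)
      (hu'.intervalIntegrable _ _), hs, smul_smul, mul_inv_cancel₀ hL.ne', one_smul]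
  have hin : ∫ y in a..b, inner ℝ s (u' y) = (b - a) * ‖s‖ ^ 2 := by
    have := (innerSL ℝ s).intervalIntegral_comp_comm (hu'.intervalIntegrable (μ := volume) a b)
    simp only [innerSL_apply_apply] at this
    rw [this, hint, real_inner_smul_right, real_inner_self_eq_norm_sq]
  have hexp : ∀ y, ‖u' y - s‖ ^ 2 = ‖u' y‖ ^ 2 - 2 * inner ℝ s (u' y) + ‖s‖ ^ 2 := by
    intro y
    rw [norm_sub_sq_real, real_inner_comm]
  have i2 : IntervalIntegrable (fun y => ‖u' y‖ ^ 2) volume a b :=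
    (hu'.norm.pow 2).intervalIntegrable _ _
  have i3 : IntervalIntegrable (fun y => 2 * inner ℝ s (u' y)) volume a b :=
    (continuous_const.mul (continuous_const.inner hu')).intervalIntegrable _ _
  simp only [hexp]
  rw [intervalIntegral.integral_add (i2.sub i3) intervalIntegrable_const,
    intervalIntegral.integral_sub i2 i3, intervalIntegral.integral_const_mul, hin,
    intervalIntegral.integral_const, smul_eq_mul]
  nlinarith [mul_nonneg hL.le (sq_nonneg ‖s‖)]

theorem ofReal_intervalIntegral_norm_sq {u : ℝ → ℂ} (hu : Continuous u) {a b : ℝ} (hab : a ≤ b) :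
    ENNReal.ofReal (∫ y in a..b, ‖u y‖ ^ 2) = ∫⁻ y in Set.Ioc a b, ‖u y‖ₑ ^ 2 := by
  have hi : IntegrableOn (fun y => ‖u y‖ ^ 2) (Set.Ioc a b) := (hu.norm.pow 2).integrableOn_Ioc
  rw [intervalIntegral.integral_of_le hab,
    ofReal_integral_eq_lintegral_ofReal hi
      (Eventually.of_forall fun y => by positivity)]
  refine lintegral_congr fun y => ?_
  rw [ENNReal.ofReal_pow (norm_nonneg _), ofReal_norm]

/-! ### Wirtinger's inequality along a zero set, in terms of the Fourier transform -/

/-- `Z` contains an ordered sequence for which every gap length, multiplied by the value of the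
weight `w` at any point of the gap, is at most `1/2`. -/
def IsGapBounded (w : ℝ → ℝ) (Z : Set ℝ) : Prop :=
  ∃ s : ℤ → ℝ, IsOrderedSeq s ∧ (∀ j, s j ∈ Z) ∧
    ∀ j, ∀ y ∈ Set.Icc (s j) (s (j + 1)), w y * (s (j + 1) - s j) ≤ 1 / 2

theorem IsOrderedSeq.iUnion_Ioc {s : ℤ → ℝ} (hs : IsOrderedSeq s) :
    ⋃ j : ℤ, Set.Ioc (s j) (s (j + 1)) = Set.univ := by
  refine Set.eq_univ_of_forall fun y => Set.mem_iUnion.2 ?_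
  obtain ⟨hm, htop, hbot⟩ := hs
  obtain ⟨N, hN⟩ := (htop.eventually_ge_atTop y).exists
  obtain ⟨M, hM⟩ := (hbot.eventually_lt_atBot y).exists
  obtain ⟨j, hj, hmax⟩ := Int.exists_greatest_of_bdd (P := fun j => s j < y)
    ⟨N, fun z hz => (hm.lt_iff_lt.1 (hz.trans_le hN)).le⟩ ⟨M, hM⟩
  refine ⟨j, hj, ?_⟩
  by_contra! h
  have := hmax _ h
  omega

theorem memLp_two_of_lintegral_ne_top {f : ℝ → ℂ} (hf : AEStronglyMeasurable f)
    (h : ∫⁻ x, ‖f x‖ₑ ^ 2 ≠ ⊤) : MemLp f 2 := by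
  refine ⟨hf, (eLpNorm_lt_top_iff_lintegral_rpow_enorm_lt_top two_ne_zero
    ENNReal.ofNat_ne_top).2 ?_⟩
  simpa using h.lt_top

theorem norm_fourier_le {g : ℝ → ℂ} (y : ℝ) : ‖𝓕 g y‖ ≤ ∫ ξ, ‖g ξ‖ :=
  VectorFourier.norm_fourierIntegral_le_integral_norm _ _ _ _ _

theorem continuous_fourier {g : ℝ → ℂ} (hg : Integrable g) : Continuous (𝓕 g) :=
  VectorFourier.fourierIntegral_continuous Real.continuous_fourierChar
    (L := innerₗ ℝ) (by exact continuous_inner) hg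

theorem tendsto_fourier_indicator {g : ℝ → ℂ} (hg : Integrable g) (y : ℝ) :
    Tendsto (fun n : ℕ => 𝓕 ((Set.Icc (-(n : ℝ)) n).indicator g) y) atTop (𝓝 (𝓕 g y)) := by
  simp only [Real.fourier_real_eq]
  refine tendsto_integral_of_dominated_convergence (fun ξ => ‖g ξ‖) (fun n => ?_) hg.norm
    (fun n => Eventually.of_forall fun ξ => ?_) (Eventually.of_forall fun ξ => ?_)
  · have h := (hg.indicator (measurableSet_Icc (a := -(n : ℝ)) (b := n))).aestronglyMeasurable
    exact (Continuous.aestronglyMeasurable (by fun_prop)).smul h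
  · rw [Circle.norm_smul]
    exact norm_indicator_le_norm_self _ _
  · refine tendsto_const_nhds.congr' ?_
    obtain ⟨N, hN⟩ := exists_nat_ge |ξ|
    filter_upwards [eventually_ge_atTop N] with n hn
    have : |ξ| ≤ n := hN.trans (by exact_mod_cast hn)
    rw [Set.indicator_of_mem (show ξ ∈ Set.Icc (-(n : ℝ)) n from abs_le.1 this)]

/-- Wirtinger's inequality summed over finitely many gaps, for a band-limited function. -/
theorem sum_wirtinger_band_limited {g : ℝ → ℂ} (hg : Integrable g)
    (hE : ∫⁻ ξ : ℝ, ENNReal.ofReal (ξ ^ 2) * ‖g ξ‖ₑ ^ 2 ≠ ⊤)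
    {s : ℤ → ℝ} (hs : IsOrderedSeq s) (t : Finset ℤ) (n : ℕ) {u : ℝ → ℂ}
    (hu : u = 𝓕 ((Set.Icc (-(n : ℝ)) n).indicator g)) :
    ∑ j ∈ t, ENNReal.ofReal ((Real.pi / (s (j + 1) - s j)) ^ 2) *
        ∫⁻ y in Set.Ioc (s j) (s (j + 1)), ‖u y - (u (s j) +
          ((y - s j) / (s (j + 1) - s j)) • (u (s (j + 1)) - u (s j)))‖ₑ ^ 2
      ≤ ENNReal.ofReal ((2 * Real.pi) ^ 2) * ∫⁻ ξ : ℝ, ENNReal.ofReal (ξ ^ 2) * ‖g ξ‖ₑ ^ 2 := by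
  set G := (Set.Icc (-(n : ℝ)) n).indicator g with hG
  have hGi : Integrable G := hg.indicator measurableSet_Icc
  have hGle : ∀ ξ, ‖G ξ‖ ≤ ‖g ξ‖ := fun ξ => norm_indicator_le_norm_self _ _
  have hxG : Integrable (fun ξ : ℝ => ξ • G ξ) := by
    refine (hg.norm.const_mul (n : ℝ)).mono'
      (continuous_id.aestronglyMeasurable.smul hGi.aestronglyMeasurable)
      (Eventually.of_forall fun ξ => ?_)
    rw [norm_smul]
    by_cases h : ξ ∈ Set.Icc (-(n : ℝ)) n
    · exact mul_le_mul (abs_le.2 h) (hGle ξ) (norm_nonneg _) (Nat.cast_nonneg n)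
    · rw [hG, Set.indicator_of_notMem h, norm_zero, mul_zero]
      positivity
  set H : ℝ → ℂ := fun ξ => (-2 * Real.pi * Complex.I * ξ) • G ξ with hH
  have hHx : H = fun ξ : ℝ => (-2 * Real.pi * Complex.I : ℂ) • (ξ • G ξ) := by
    funext ξ
    simp only [hH, smul_eq_mul, Complex.real_smul]
    ring
  have hHi : Integrable H := hHx ▸ hxG.smul (-2 * Real.pi * Complex.I : ℂ)
  have hHE : ∫⁻ ξ, ‖H ξ‖ₑ ^ 2
      ≤ ENNReal.ofReal ((2 * Real.pi) ^ 2) * ∫⁻ ξ : ℝ, ENNReal.ofReal (ξ ^ 2) * ‖g ξ‖ₑ ^ 2 := by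
    rw [← lintegral_const_mul' _ _ ENNReal.ofReal_ne_top]
    refine lintegral_mono fun ξ => ?_
    rw [← ofReal_norm, ← ofReal_norm, ← ENNReal.ofReal_pow (norm_nonneg _),
      ← ENNReal.ofReal_pow (norm_nonneg _), ← ENNReal.ofReal_mul (by positivity),
      ← ENNReal.ofReal_mul (by positivity)]
    refine ENNReal.ofReal_le_ofReal ?_
    have e : ‖H ξ‖ = 2 * Real.pi * |ξ| * ‖G ξ‖ := by
      simp [hH, abs_of_pos Real.pi_pos]
    rw [e, mul_pow, mul_pow, sq_abs, ← mul_assoc]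
    have := hGle ξ
    gcongr
  have hH2 : MemLp H 2 := memLp_two_of_lintegral_ne_top hHi.aestronglyMeasurable
    (ne_top_of_le_ne_top (ENNReal.mul_ne_top ENNReal.ofReal_ne_top hE) hHE)
  have hd : ∀ y, HasDerivAt u (𝓕 H y) y := fun y => hu ▸ Real.hasDerivAt_fourier hGi hxG y
  have hc' : Continuous (𝓕 H) := continuous_fourier hHi
  have huc : Continuous u := hu ▸ continuous_fourier hGi
  have hterm : ∀ j, ENNReal.ofReal ((Real.pi / (s (j + 1) - s j)) ^ 2) *
        ∫⁻ y in Set.Ioc (s j) (s (j + 1)), ‖u y - (u (s j) +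
          ((y - s j) / (s (j + 1) - s j)) • (u (s (j + 1)) - u (s j)))‖ₑ ^ 2
      ≤ ∫⁻ y in Set.Ioc (s j) (s (j + 1)), ‖𝓕 H y‖ₑ ^ 2 := by
    intro j
    have hlt : s j < s (j + 1) := hs.1 (lt_add_one j)
    rw [← ofReal_intervalIntegral_norm_sq hc' hlt.le,
      ← ofReal_intervalIntegral_norm_sq (by fun_prop) hlt.le,
      ← ENNReal.ofReal_mul (by positivity)]
    exact ENNReal.ofReal_le_ofReal (wirtinger_sub_interpolation hlt hd hc')
  calc _ ≤ ∑ j ∈ t, ∫⁻ y in Set.Ioc (s j) (s (j + 1)), ‖𝓕 H y‖ₑ ^ 2 :=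
        Finset.sum_le_sum fun j _ => hterm j
    _ = ∫⁻ y in ⋃ j ∈ t, Set.Ioc (s j) (s (j + 1)), ‖𝓕 H y‖ₑ ^ 2 := by
        rw [lintegral_biUnion_finset _ fun j _ => measurableSet_Ioc]
        intro i _ j _ hij
        exact hs.1.monotone.pairwise_disjoint_on_Ioc_succ hij
    _ ≤ ∫⁻ y, ‖𝓕 H y‖ₑ ^ 2 := setLIntegral_le_lintegral _ _
    _ = ∫⁻ ξ, ‖H ξ‖ₑ ^ 2 := lintegral_enorm_fourier_sq hHi hH2
    _ ≤ _ := hHE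

/-- The sum over finitely many gaps for a function vanishing at all the points of the sequence,
by passing to the limit in the band-limited truncations. -/
theorem sum_wirtinger_of_zeros {g : ℝ → ℂ} (hg : Integrable g)
    (hE : ∫⁻ ξ : ℝ, ENNReal.ofReal (ξ ^ 2) * ‖g ξ‖ₑ ^ 2 ≠ ⊤)
    {s : ℤ → ℝ} (hs : IsOrderedSeq s) (hz : ∀ j, 𝓕 g (s j) = 0) (t : Finset ℤ) :
    ∑ j ∈ t, ENNReal.ofReal ((Real.pi / (s (j + 1) - s j)) ^ 2) *
        ∫⁻ y in Set.Ioc (s j) (s (j + 1)), ‖𝓕 g y‖ₑ ^ 2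
      ≤ ENNReal.ofReal ((2 * Real.pi) ^ 2) * ∫⁻ ξ : ℝ, ENNReal.ofReal (ξ ^ 2) * ‖g ξ‖ₑ ^ 2 := by
  set u : ℕ → ℝ → ℂ := fun n => 𝓕 ((Set.Icc (-(n : ℝ)) n).indicator g) with hu
  have hGi : ∀ n : ℕ, Integrable ((Set.Icc (-(n : ℝ)) n).indicator g) :=
    fun n => hg.indicator measurableSet_Icc
  have huc : ∀ n, Continuous (u n) := fun n => continuous_fourier (hGi n)
  set B := ∫ ξ, ‖g ξ‖
  have hub : ∀ n y, ‖u n y‖ ≤ B := fun n y =>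
    (norm_fourier_le y).trans (integral_mono (hGi n).norm hg.norm
      fun ξ => norm_indicator_le_norm_self _ _)
  have hlim : Tendsto (fun n => ∑ j ∈ t, ENNReal.ofReal ((Real.pi / (s (j + 1) - s j)) ^ 2) *
        ∫⁻ y in Set.Ioc (s j) (s (j + 1)), ‖u n y - (u n (s j) +
          ((y - s j) / (s (j + 1) - s j)) • (u n (s (j + 1)) - u n (s j)))‖ₑ ^ 2) atTop
      (𝓝 (∑ j ∈ t, ENNReal.ofReal ((Real.pi / (s (j + 1) - s j)) ^ 2) *
        ∫⁻ y in Set.Ioc (s j) (s (j + 1)), ‖𝓕 g y‖ₑ ^ 2)) := by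
    refine tendsto_finsetSum _ fun j _ =>
      ENNReal.Tendsto.const_mul ?_ (Or.inr ENNReal.ofReal_ne_top)
    have hlt : s j < s (j + 1) := hs.1 (lt_add_one j)
    have hL : 0 < s (j + 1) - s j := sub_pos.2 hlt
    refine tendsto_lintegral_of_dominated_convergence
      (fun _ => ENNReal.ofReal (4 * B) ^ 2) (fun n => ?_) (fun n => ?_) ?_ ?_
    · have := huc n
      exact Continuous.measurable (by fun_prop)
    · refine (ae_restrict_mem measurableSet_Ioc).mono fun y hy => ?_
      beta_reduce
      rw [← ofReal_norm]
      gcongr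
      have h0 : 0 ≤ (y - s j) / (s (j + 1) - s j) := div_nonneg (by linarith [hy.1]) hL.le
      have h1 : (y - s j) / (s (j + 1) - s j) ≤ 1 := (div_le_one hL).2 (by linarith [hy.2])
      have h2 : ‖((y - s j) / (s (j + 1) - s j)) • (u n (s (j + 1)) - u n (s j))‖ ≤ 1 * (B + B) := by
        rw [norm_smul, Real.norm_of_nonneg h0]
        exact mul_le_mul h1 ((norm_sub_le _ _).trans (add_le_add (hub _ _) (hub _ _)))
          (norm_nonneg _) zero_le_one
      have h3 := norm_sub_le (u n y) (u n (s j) +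
        ((y - s j) / (s (j + 1) - s j)) • (u n (s (j + 1)) - u n (s j)))
      have h4 := norm_add_le (u n (s j))
        (((y - s j) / (s (j + 1) - s j)) • (u n (s (j + 1)) - u n (s j)))
      linarith [hub n y, hub n (s j)]
    · simp only [lintegral_const, Measure.restrict_apply_univ, Real.volume_Ioc]
      exact ENNReal.mul_ne_top (ENNReal.pow_ne_top ENNReal.ofReal_ne_top) ENNReal.ofReal_ne_top
    · refine Eventually.of_forall fun y => ?_
      have h1 := (tendsto_fourier_indicator hg y).sub
        ((tendsto_fourier_indicator hg (s j)).add
          (((tendsto_fourier_indicator hg (s (j + 1))).sub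
            (tendsto_fourier_indicator hg (s j))).const_smul
              ((y - s j) / (s (j + 1) - s j))))
      rw [hz, hz, sub_zero, smul_zero, add_zero, sub_zero] at h1
      have h2 := ((ENNReal.continuous_pow 2).tendsto _).comp ((continuous_enorm.tendsto _).comp h1)
      exact h2
  exact le_of_tendsto hlim
    (Eventually.of_forall fun n => sum_wirtinger_band_limited hg hE hs t n rfl)

/-- If `𝓕 g` vanishes on a set with `w`-bounded gaps, then multiplication by `w` is dominated by
differentiation, that is, by multiplication of `g` by the frequency. -/
theorem wirtinger_fourier {g : ℝ → ℂ} (hg : Integrable g) {w : ℝ → ℝ} (hw : ∀ y, 0 ≤ w y)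
    {Z : Set ℝ} (hZ : IsGapBounded w Z) (hz : ∀ y ∈ Z, 𝓕 g y = 0) :
    ∫⁻ y, ENNReal.ofReal (w y ^ 2) * ‖𝓕 g y‖ₑ ^ 2
      ≤ ∫⁻ ξ : ℝ, ENNReal.ofReal (ξ ^ 2) * ‖g ξ‖ₑ ^ 2 := by
  by_cases hE : ∫⁻ ξ : ℝ, ENNReal.ofReal (ξ ^ 2) * ‖g ξ‖ₑ ^ 2 = ⊤
  · exact hE ▸ le_top
  obtain ⟨s, hs, hsZ, hgap⟩ := hZ
  have hsum := sum_wirtinger_of_zeros hg hE hs fun j => hz _ (hsZ j)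
  have hC0 : ENNReal.ofReal ((2 * Real.pi) ^ 2) ≠ 0 :=
    (ENNReal.ofReal_pos.2 (by positivity)).ne'
  refine (ENNReal.mul_le_mul_iff_right hC0 ENNReal.ofReal_ne_top).1 ?_
  have hdisj : Pairwise (Function.onFun Disjoint fun j : ℤ => Set.Ioc (s j) (s (j + 1))) :=
    hs.1.monotone.pairwise_disjoint_on_Ioc_succ
  rw [← setLIntegral_univ (fun y => ENNReal.ofReal (w y ^ 2) * ‖𝓕 g y‖ₑ ^ 2), ← hs.iUnion_Ioc,
    lintegral_iUnion (fun j => measurableSet_Ioc) hdisj,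
    ← ENNReal.tsum_mul_left, ENNReal.tsum_eq_iSup_sum]
  refine iSup_le fun t => (Finset.sum_le_sum fun j _ => ?_).trans (hsum t)
  rw [← lintegral_const_mul' _ _ ENNReal.ofReal_ne_top,
    ← lintegral_const_mul' _ _ ENNReal.ofReal_ne_top]
  refine setLIntegral_mono_ae' measurableSet_Ioc (Eventually.of_forall fun y hy => ?_)
  rw [← mul_assoc, ← ENNReal.ofReal_mul (by positivity)]
  gcongr
  have hL : 0 < s (j + 1) - s j := sub_pos.2 (hs.1 (lt_add_one j))
  have h1 := hgap j y (Set.Ioc_subset_Icc_self hy)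
  rw [← mul_pow]
  have h2 : 2 * Real.pi * w y ≤ Real.pi / (s (j + 1) - s j) := by
    rw [le_div_iff₀ hL]
    nlinarith [Real.pi_pos]
  exact pow_le_pow_left₀ (mul_nonneg (by positivity) (hw y)) h2 2

/-! ### The short-time Fourier transform -/

/-- The short-time Fourier transform of `𝓕 g` with window `𝓕 ψ`, written on the frequency side:
`gabor ψ g x ξ = ∫ ψ(ζ) g(ξ - ζ) exp(2πixζ) dζ`. As a function of `ξ` it is the inverse Fourier
transform of `𝓕 ψ (· - x) * 𝓕 g`. -/
noncomputable def gabor (ψ g : ℝ → ℂ) (x ξ : ℝ) : ℂ :=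
  𝓕 (fun ζ => ψ ζ * g (ξ - ζ)) (-x)

theorem memLp_two_of_bounded {f : ℝ → ℂ} (hf : Integrable f) {B : ℝ} (hB : ∀ x, ‖f x‖ ≤ B) :
    MemLp f 2 := by
  refine memLp_two_of_lintegral_ne_top hf.aestronglyMeasurable ?_
  refine ne_top_of_le_ne_top (ENNReal.mul_ne_top ENNReal.ofReal_ne_top hf.hasFiniteIntegral.ne)
    (b := ENNReal.ofReal B * ∫⁻ x, ‖f x‖ₑ) ?_
  rw [← lintegral_const_mul' _ _ ENNReal.ofReal_ne_top]
  refine lintegral_mono fun x => ?_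
  rw [sq, ← ofReal_norm (f x)]
  gcongr
  exact hB x

theorem gabor_eq_convolution (ψ g : ℝ → ℂ) (x : ℝ) :
    gabor ψ g x = MeasureTheory.convolution
      (fun ζ => Real.fourierChar (ζ * x) • ψ ζ) g (ContinuousLinearMap.mul ℂ ℂ) volume := by
  funext ξ
  simp only [gabor, Real.fourier_real_eq, MeasureTheory.convolution, ContinuousLinearMap.mul_apply']
  refine integral_congr_ae (Eventually.of_forall fun ζ => ?_)
  simp only [mul_neg, neg_neg, smul_mul_assoc]

theorem integrable_modulate {ψ : ℝ → ℂ} (hψ : Integrable ψ) (x : ℝ) :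
    Integrable fun ζ => Real.fourierChar (ζ * x) • ψ ζ := by
  refine hψ.mono ((Continuous.aestronglyMeasurable (by fun_prop)).smul hψ.aestronglyMeasurable)
    (Eventually.of_forall fun ζ => ?_)
  rw [Circle.norm_smul]

theorem integrable_gabor {ψ g : ℝ → ℂ} (hψ : Integrable ψ) (hg : Integrable g) (x : ℝ) :
    Integrable (gabor ψ g x) := by
  rw [gabor_eq_convolution]
  exact (integrable_modulate hψ x).integrable_convolution _ hg

theorem fourier_gabor {ψ g : ℝ → ℂ} (hψ : Integrable ψ) (hg : Integrable g) (x y : ℝ) :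
    𝓕 (gabor ψ g x) y = 𝓕 ψ (y - x) * 𝓕 g y := by
  rw [gabor_eq_convolution, Real.fourier_mul_convolution_eq (integrable_modulate hψ x) hg]
  congr 1
  simp only [Real.fourier_real_eq]
  refine integral_congr_ae (Eventually.of_forall fun ζ => ?_)
  beta_reduce
  rw [smul_smul, ← AddChar.map_add_eq_mul]
  congr 2
  ring

theorem norm_gabor_le {ψ g : ℝ → ℂ} (hψ : Integrable ψ) {B : ℝ} (hB : ∀ x, ‖g x‖ ≤ B) (x ξ : ℝ) :
    ‖gabor ψ g x ξ‖ ≤ ∫ ζ, ‖ψ ζ‖ * B := by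
  refine (norm_fourier_le _).trans ?_
  refine integral_mono_of_nonneg (Eventually.of_forall fun ζ => norm_nonneg _)
    (hψ.norm.mul_const B) (Eventually.of_forall fun ζ => ?_)
  beta_reduce
  rw [norm_mul]
  gcongr
  exact hB _

/-- Plancherel's theorem for the short-time Fourier transform in the frequency variable. -/
theorem lintegral_gabor_sq_right {ψ g : ℝ → ℂ} (hψ : Integrable ψ) (hg : Integrable g)
    {B : ℝ} (hB : ∀ x, ‖g x‖ ≤ B) (x : ℝ) :
    ∫⁻ ξ, ‖gabor ψ g x ξ‖ₑ ^ 2 = ∫⁻ y, ‖𝓕 ψ (y - x)‖ₑ ^ 2 * ‖𝓕 g y‖ₑ ^ 2 := by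
  rw [← lintegral_enorm_fourier_sq (integrable_gabor hψ hg x)
    (memLp_two_of_bounded (integrable_gabor hψ hg x) (norm_gabor_le hψ hB x))]
  simp only [fourier_gabor hψ hg, enorm_mul, mul_pow]

/-- Plancherel's theorem for the short-time Fourier transform in the space variable. -/
theorem lintegral_gabor_sq_left {ψ g : ℝ → ℂ} (hψ : Integrable ψ) (hg : Integrable g)
    {A B : ℝ} (hA : ∀ x, ‖ψ x‖ ≤ A) (hB : ∀ x, ‖g x‖ ≤ B) (ξ : ℝ) :
    ∫⁻ x, ‖gabor ψ g x ξ‖ₑ ^ 2 = ∫⁻ ζ, ‖ψ ζ‖ₑ ^ 2 * ‖g (ξ - ζ)‖ₑ ^ 2 := by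
  have hB0 : 0 ≤ B := (norm_nonneg _).trans (hB 0)
  have h1 : Integrable fun ζ => ψ ζ * g (ξ - ζ) :=
    hψ.mul_bdd (c := B) (hg.comp_sub_left ξ).aestronglyMeasurable
      (Eventually.of_forall fun ζ => hB _)
  have h2 : MemLp (fun ζ => ψ ζ * g (ξ - ζ)) 2 := by
    refine memLp_two_of_bounded h1 (B := A * B) fun ζ => ?_
    rw [norm_mul]
    exact mul_le_mul (hA _) (hB _) (norm_nonneg _) ((norm_nonneg _).trans (hA 0))
  have h3 := lintegral_enorm_fourier_sq h1 h2
  simp only [gabor]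
  rw [lintegral_neg_eq_self (fun x => ‖𝓕 (fun ζ => ψ ζ * g (ξ - ζ)) x‖ₑ ^ 2), h3]
  simp only [enorm_mul, mul_pow]

theorem measurable_gabor {ψ g : ℝ → ℂ} (hψ : Continuous ψ) (hg : Continuous g) :
    Measurable fun z : ℝ × ℝ => gabor ψ g z.1 z.2 := by
  simp only [gabor, Real.fourier_real_eq]
  have h : Continuous fun w : (ℝ × ℝ) × ℝ =>
      Real.fourierChar (-(w.2 * -w.1.1)) • (ψ w.2 * g (w.1.2 - w.2)) := by fun_prop
  exact h.stronglyMeasurable.integral_prod_right'.measurable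

/-! ### Scalar inequalities and the window -/

/-- Young's inequality in the form that dominates the mixed symbol `|x| ^ (2 (1 - r)) * ξ ^ 2` by a
function of `x` plus a function of `ξ`. -/
theorem young_symbol {r : ℝ} (hr : 0 < r) (hr1 : r ≤ 1) (x ξ : ℝ) :
    (|x| + 2) ^ (2 * (1 - r)) * ξ ^ 2 ≤ (1 - r) * (|x| + 2) ^ 2 + r * |ξ| ^ (2 / r) := by
  have hx : 0 ≤ |x| + 2 := by positivity
  have h := Real.geom_mean_le_arith_mean2_weighted (sub_nonneg.2 hr1) hr.le
    (sq_nonneg (|x| + 2)) (Real.rpow_nonneg (abs_nonneg ξ) (2 / r)) (by ring)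
  rw [← Real.rpow_natCast, ← Real.rpow_mul hx, ← Real.rpow_mul (abs_nonneg ξ),
    div_mul_cancel₀ _ hr.ne'] at h
  simpa using h

/-- The shift by `3 ^ (1 / r)` in the weight of order `r` outweighs the loss of `2` in passing from
`|y| + 1` to `|y| + 3`: with `v = 1 / (u + 1)` the inequality is the convexity bound
`(1 + 2 v) ^ (1 / r) ≤ (1 - v) + v 3 ^ (1 / r)`. -/
theorem shift_le_geom_mean {r u : ℝ} (hr : 0 < r) (hr1 : r ≤ 1) (hu : 0 ≤ u) :
    u + 3 ≤ (u + 3 ^ (1 / r)) ^ r * (u + 1) ^ (1 - r) := by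
  have hu1 : 0 < u + 1 := by linarith
  have hD : (0 : ℝ) ≤ 3 ^ (1 / r) := by positivity
  have hm : 1 ≤ 1 / r := (one_le_div hr).2 hr1
  have hconv := (convexOn_rpow hm).2 (show (1 : ℝ) ∈ Set.Ici 0 by simp)
    (show (3 : ℝ) ∈ Set.Ici 0 by simp) (show 0 ≤ u / (u + 1) by positivity)
    (show 0 ≤ 1 / (u + 1) by positivity) (by field_simp)
  simp only [smul_eq_mul, Real.one_rpow, mul_one] at hconv
  have e1 : u / (u + 1) + 1 / (u + 1) * 3 = (u + 3) / (u + 1) := by ring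
  have e2 : u / (u + 1) + 1 / (u + 1) * 3 ^ (1 / r) = (u + 3 ^ (1 / r)) / (u + 1) := by ring
  rw [e1, e2] at hconv
  have h3 := Real.rpow_le_rpow (by positivity) hconv hr.le
  rw [← Real.rpow_mul (by positivity), one_div_mul_cancel hr.ne', Real.rpow_one,
    Real.div_rpow (by positivity) hu1.le, div_le_div_iff₀ hu1 (by positivity)] at h3
  have e3 : (u + 1) = (u + 1) ^ r * (u + 1) ^ (1 - r) := by
    rw [← Real.rpow_add hu1]
    simp
  have hpos : 0 < (u + 1) ^ r := by positivity
  refine le_of_mul_le_mul_right (h3.trans_eq ?_) hpos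
  rw [mul_assoc, mul_comm ((u + 1) ^ (1 - r)), ← e3]

/-- A pointwise form of Minkowski's inequality in `L^m`: convexity along the decomposition of
`a + b` as a mean of `a + C` and `(a + C) b / C`. -/
theorem add_rpow_le {m a b C : ℝ} (hm : 1 ≤ m) (ha : 0 ≤ a) (hb : 0 ≤ b) (hC : 0 < C) :
    (a + b) ^ m ≤ (a + C) ^ m * (a / (a + C)) + (a + C) ^ m * (C / (a + C) / C ^ m) * b ^ m := by
  have hs : 0 < a + C := by linarith
  have hconv := (convexOn_rpow hm).2 (Set.mem_Ici.2 hs.le)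
    (Set.mem_Ici.2 (show 0 ≤ (a + C) * b / C by positivity))
    (show 0 ≤ a / (a + C) by positivity) (show 0 ≤ C / (a + C) by positivity) (by field_simp)
  simp only [smul_eq_mul] at hconv
  have e1 : a / (a + C) * (a + C) + C / (a + C) * ((a + C) * b / C) = a + b := by field_simp
  rw [e1, Real.div_rpow (by positivity) hC.le, Real.mul_rpow hs.le hb] at hconv
  refine hconv.trans (le_of_eq ?_)
  ring

/-- There is a Schwartz function of unit `L²` norm with Fourier transform supported in
`[-1, 1]`. -/
theorem exists_window : ∃ ψ : SchwartzMap ℝ ℂ,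
    (∀ y, 1 < |y| → 𝓕 (ψ : ℝ → ℂ) y = 0) ∧ ∫⁻ ζ, ‖ψ ζ‖ₑ ^ 2 = 1 := by
  let b : ContDiffBump (0 : ℝ) := ⟨1 / 2, 1, by norm_num, by norm_num⟩
  have hbc : HasCompactSupport (fun x => (b x : ℂ)) :=
    b.hasCompactSupport.comp_left (g := fun t : ℝ => (t : ℂ)) (by simp)
  let Φ : SchwartzMap ℝ ℂ := hbc.toSchwartzMap (Complex.ofRealCLM.contDiff.comp b.contDiff)
  have hΦ : ∀ x, Φ x = (b x : ℂ) := fun x => rfl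
  let ψ₀ : SchwartzMap ℝ ℂ := 𝓕⁻ Φ
  have hF : 𝓕 ψ₀ = Φ := FourierTransform.fourier_fourierInv_eq Φ
  have hFc : 𝓕 (ψ₀ : ℝ → ℂ) = Φ := by rw [← SchwartzMap.fourier_coe, hF]
  have hfin : ∫⁻ ζ, ‖ψ₀ ζ‖ₑ ^ 2 ≠ ⊤ := by
    have h := (eLpNorm_lt_top_iff_lintegral_rpow_enorm_lt_top two_ne_zero
      ENNReal.ofNat_ne_top).1 (ψ₀.memLp 2 volume).2
    simpa using h.ne
  have hne : ∫⁻ ζ, ‖ψ₀ ζ‖ₑ ^ 2 ≠ 0 := by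
    intro h
    rw [lintegral_eq_zero_iff (by fun_prop)] at h
    have h0 : (ψ₀ : ℝ → ℂ) =ᵐ[volume] 0 := by
      filter_upwards [h] with x hx
      simpa using hx
    have h1 : 𝓕 (ψ₀ : ℝ → ℂ) 0 = 0 := by
      rw [Real.fourier_congr_ae h0, Real.fourier_real_eq]
      simp
    rw [hFc, hΦ, b.one_of_mem_closedBall (by simp [b])] at h1
    simp at h1
  set c := (∫⁻ ζ, ‖ψ₀ ζ‖ₑ ^ 2).toReal with hc
  have hc0 : 0 < c := ENNReal.toReal_pos hne hfin
  refine ⟨((Real.sqrt c)⁻¹ : ℂ) • ψ₀, fun y hy => ?_, ?_⟩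
  · have h1 : 𝓕 ψ₀ y = 0 := by
      rw [hF, hΦ, b.zero_of_le_dist (by simpa [b] using hy.le)]
      simp
    rw [← SchwartzMap.fourier_coe, FourierTransform.fourier_smul, smul_apply, h1,
      smul_zero]
  · simp only [smul_apply, enorm_smul, mul_pow]
    rw [lintegral_const_mul' _ _ (by finiteness), ← ENNReal.ofReal_toReal hfin, ← hc,
      ← ofReal_norm, ← ENNReal.ofReal_pow (norm_nonneg _),
      ← ENNReal.ofReal_mul (by positivity)]
    rw [norm_inv, Complex.norm_real, Real.norm_of_nonneg (Real.sqrt_nonneg _), inv_pow,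
      Real.sq_sqrt hc0.le, inv_mul_cancel₀ hc0.ne', ENNReal.ofReal_one]

theorem lintegral_rpow_mul_schwartz_ne_top (ψ : SchwartzMap ℝ ℂ) {m : ℝ} (hm : 0 ≤ m) :
    ∫⁻ ζ, ENNReal.ofReal (|ζ| ^ m) * ‖ψ ζ‖ₑ ^ 2 ≠ ⊤ := by
  obtain ⟨N, hN⟩ := exists_nat_ge m
  obtain ⟨A, -, hA⟩ := ψ.decay 0 0
  simp only [pow_zero, norm_iteratedFDeriv_zero, one_mul] at hA
  have hA0 : 0 ≤ A := (norm_nonneg _).trans (hA 0)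
  have hi : Integrable fun ζ : ℝ => A * (‖ψ ζ‖ + ‖ζ‖ ^ N * ‖ψ ζ‖) :=
    (ψ.integrable.norm.add (ψ.integrable_pow_mul volume N)).const_mul A
  refine ne_top_of_le_ne_top hi.hasFiniteIntegral.ne (lintegral_mono fun ζ => ?_)
  rw [← ofReal_norm, ← ENNReal.ofReal_pow (norm_nonneg _), ← ENNReal.ofReal_mul (by positivity),
    ← ofReal_norm]
  refine ENNReal.ofReal_le_ofReal ?_
  beta_reduce
  rw [Real.norm_of_nonneg (by positivity), Real.norm_eq_abs]
  have h1 : |ζ| ^ m ≤ 1 + |ζ| ^ N := by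
    rcases le_total |ζ| 1 with h | h
    · have := Real.rpow_le_one (abs_nonneg ζ) h hm
      have h2 : 0 ≤ |ζ| ^ N := by positivity
      linarith
    · have := Real.rpow_le_rpow_of_exponent_le h hN
      rw [Real.rpow_natCast] at this
      linarith
  calc |ζ| ^ m * ‖ψ ζ‖ ^ 2 ≤ (1 + |ζ| ^ N) * (A * ‖ψ ζ‖) := by
        rw [sq]
        gcongr
        exact hA ζ
    _ = _ := by ring

/-- Averaging `|η + ζ| ^ m` against a probability density shifts `|η|` by at most the `m`-th root
of the `m`-th moment; the constant `1 + moment` is a convenient upper bound for that root. -/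
theorem lintegral_add_rpow_le {ψ : ℝ → ℂ} {m : ℝ} (hm : 1 ≤ m)
    (h1 : ∫⁻ ζ, ‖ψ ζ‖ₑ ^ 2 = 1) (hψ : Measurable ψ)
    (hM : ∫⁻ ζ, ENNReal.ofReal (|ζ| ^ m) * ‖ψ ζ‖ₑ ^ 2 ≠ ⊤) (η : ℝ) :
    ∫⁻ ζ, ENNReal.ofReal (|η + ζ| ^ m) * ‖ψ ζ‖ₑ ^ 2
      ≤ ENNReal.ofReal
        ((|η| + (1 + (∫⁻ ζ, ENNReal.ofReal (|ζ| ^ m) * ‖ψ ζ‖ₑ ^ 2).toReal)) ^ m) := by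
  set M := ∫⁻ ζ, ENNReal.ofReal (|ζ| ^ m) * ‖ψ ζ‖ₑ ^ 2 with hMdef
  set C := 1 + M.toReal with hC
  have hM0 : 0 ≤ M.toReal := ENNReal.toReal_nonneg
  have hC0 : 0 < C := by positivity
  have hs : 0 < |η| + C := by positivity
  set a := (|η| + C) ^ m * (|η| / (|η| + C)) with ha
  set b := (|η| + C) ^ m * (C / (|η| + C) / C ^ m) with hb
  have ha0 : 0 ≤ a := by positivity
  have hb0 : 0 ≤ b := by positivity
  calc ∫⁻ ζ, ENNReal.ofReal (|η + ζ| ^ m) * ‖ψ ζ‖ₑ ^ 2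
      ≤ ∫⁻ ζ, (ENNReal.ofReal a * ‖ψ ζ‖ₑ ^ 2
          + ENNReal.ofReal b * (ENNReal.ofReal (|ζ| ^ m) * ‖ψ ζ‖ₑ ^ 2)) := by
        refine lintegral_mono fun ζ => ?_
        rw [← mul_assoc, ← ENNReal.ofReal_mul hb0, ← add_mul,
          ← ENNReal.ofReal_add ha0 (by positivity)]
        gcongr
        exact (Real.rpow_le_rpow (abs_nonneg _) (abs_add_le η ζ) (by linarith)).trans
          (add_rpow_le hm (abs_nonneg η) (abs_nonneg ζ) hC0)
    _ = ENNReal.ofReal a + ENNReal.ofReal b * M := by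
        rw [lintegral_add_left (by fun_prop), lintegral_const_mul' _ _ ENNReal.ofReal_ne_top,
          lintegral_const_mul' _ _ ENNReal.ofReal_ne_top, h1, mul_one]
    _ = ENNReal.ofReal (a + b * M.toReal) := by
        rw [ENNReal.ofReal_add ha0 (by positivity), ENNReal.ofReal_mul hb0,
          ENNReal.ofReal_toReal hM]
    _ ≤ _ := by
        refine ENNReal.ofReal_le_ofReal ?_
        have hCm : M.toReal ≤ C ^ m := by
          have : C ^ (1 : ℝ) ≤ C ^ m :=
            Real.rpow_le_rpow_of_exponent_le (by linarith) hm
          rw [Real.rpow_one] at this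
          linarith
        calc a + b * M.toReal ≤ a + b * C ^ m := by gcongr
          _ = (|η| + C) ^ m := by
            rw [ha, hb]
            have : 0 < C ^ m := by positivity
            field_simp

/-! ### The energy argument -/

theorem lintegral_lintegral_linear {F G : ℝ × ℝ → ENNReal} (hF : Measurable F) {a b : ENNReal}
    (ha : a ≠ ⊤) (hb : b ≠ ⊤) :
    ∫⁻ x, ∫⁻ ξ, (a * F (x, ξ) + b * G (x, ξ))
      = a * (∫⁻ x, ∫⁻ ξ, F (x, ξ)) + b * ∫⁻ x, ∫⁻ ξ, G (x, ξ) := by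
  rw [← lintegral_const_mul' _ _ ha, ← lintegral_const_mul' _ _ hb, ← lintegral_add_left]
  · refine lintegral_congr fun x => ?_
    rw [← lintegral_const_mul' _ _ ha, ← lintegral_const_mul' _ _ hb, ← lintegral_add_left]
    exact (hF.comp measurable_prodMk_left).const_mul a
  · exact hF.lintegral_prod_right'.const_mul a

section Energy

variable {ψ g : ℝ → ℂ} {r : ℝ}

/-- Wirtinger's inequality along the zeros of `𝓕 g`, applied to all the products
`𝓕 ψ (· - x) * 𝓕 g` and integrated against the weight `(|x| + 2) ^ (2 (1 - r))`. As `𝓕 ψ` is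
supported in `[-1, 1]`, the weight is at least `(|y| + 1) ^ (2 (1 - r))` at the relevant points. -/
theorem energy_le_lintegral_gabor (hr : 0 < r) (hr1 : r ≤ 1)
    (hψi : Integrable ψ) (hψ1 : ∫⁻ y, ‖𝓕 ψ y‖ₑ ^ 2 = 1)
    (hsupp : ∀ y, 1 < |y| → 𝓕 ψ y = 0) (hgi : Integrable g)
    {Z : Set ℝ} (hZ : IsGapBounded (fun y => (|y| + 3 ^ (1 / r)) ^ r) Z)
    (hz : ∀ y ∈ Z, 𝓕 g y = 0) :
    ∫⁻ y, ENNReal.ofReal ((|y| + 3) ^ 2) * ‖𝓕 g y‖ₑ ^ 2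
      ≤ ∫⁻ x, ∫⁻ ξ, ENNReal.ofReal ((|x| + 2) ^ (2 * (1 - r)) * ξ ^ 2) * ‖gabor ψ g x ξ‖ₑ ^ 2 := by
  have hΦ : Measurable (𝓕 ψ) := (continuous_fourier hψi).measurable
  have hf : Measurable (𝓕 g) := (continuous_fourier hgi).measurable
  set D : ℝ := 3 ^ (1 / r)
  have hD0 : 0 ≤ D := by positivity
  calc ∫⁻ y, ENNReal.ofReal ((|y| + 3) ^ 2) * ‖𝓕 g y‖ₑ ^ 2
      = ∫⁻ y, ∫⁻ x, ENNReal.ofReal ((|y| + 3) ^ 2) * ‖𝓕 g y‖ₑ ^ 2 * ‖𝓕 ψ (y - x)‖ₑ ^ 2 := by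
        refine lintegral_congr fun y => ?_
        rw [lintegral_const_mul _ (by fun_prop),
          lintegral_sub_left_eq_self (fun x => ‖𝓕 ψ x‖ₑ ^ 2) y, hψ1, mul_one]
    _ = ∫⁻ x, ∫⁻ y, ENNReal.ofReal ((|y| + 3) ^ 2) * ‖𝓕 g y‖ₑ ^ 2 * ‖𝓕 ψ (y - x)‖ₑ ^ 2 :=
        lintegral_lintegral_swap (Measurable.aemeasurable (by fun_prop))
    _ ≤ ∫⁻ x, ∫⁻ y, ENNReal.ofReal ((|x| + 2) ^ (2 * (1 - r))) *
          (ENNReal.ofReal (((|y| + D) ^ r) ^ 2) * ‖𝓕 (gabor ψ g x) y‖ₑ ^ 2) := by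
        refine lintegral_mono fun x => lintegral_mono fun y => ?_
        rw [fourier_gabor hψi hgi, enorm_mul, mul_pow]
        rcases lt_or_ge 1 |y - x| with h | h
        · simp [hsupp _ h]
        rw [← mul_assoc, ← ENNReal.ofReal_mul (by positivity), mul_assoc,
          mul_comm (‖𝓕 g y‖ₑ ^ 2)]
        gcongr
        have h1 := shift_le_geom_mean hr hr1 (abs_nonneg y)
        have h2 : |y| + 1 ≤ |x| + 2 := by
          have := abs_sub_abs_le_abs_sub y x
          linarith
        have h3 : (|y| + 1) ^ (1 - r) ≤ (|x| + 2) ^ (1 - r) :=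
          Real.rpow_le_rpow (by positivity) h2 (by linarith)
        have e : (|x| + 2) ^ (2 * (1 - r)) = ((|x| + 2) ^ (1 - r)) ^ 2 := by
          rw [mul_comm, Real.rpow_mul (by positivity), Real.rpow_two]
        rw [e, ← mul_pow]
        refine pow_le_pow_left₀ (by positivity) (h1.trans ?_) 2
        rw [mul_comm]
        gcongr
    _ ≤ ∫⁻ x, ENNReal.ofReal ((|x| + 2) ^ (2 * (1 - r))) *
          ∫⁻ ξ, ENNReal.ofReal (ξ ^ 2) * ‖gabor ψ g x ξ‖ₑ ^ 2 := by
        refine lintegral_mono fun x => ?_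
        rw [lintegral_const_mul' _ _ ENNReal.ofReal_ne_top]
        refine mul_le_mul' le_rfl (wirtinger_fourier (integrable_gabor hψi hgi x)
          (fun y => by positivity) hZ fun y hy => ?_)
        rw [fourier_gabor hψi hgi, hz y hy, mul_zero]
    _ = _ := by
        refine lintegral_congr fun x => ?_
        rw [← lintegral_const_mul' _ _ ENNReal.ofReal_ne_top]
        refine lintegral_congr fun ξ => ?_
        rw [ENNReal.ofReal_mul (by positivity), mul_assoc]

/-- The part of the energy controlled by the position. -/
theorem lintegral_gabor_position_le
    (hψi : Integrable ψ) (hψ1 : ∫⁻ y, ‖𝓕 ψ y‖ₑ ^ 2 = 1)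
    (hsupp : ∀ y, 1 < |y| → 𝓕 ψ y = 0) (hgi : Integrable g) {B : ℝ} (hB : ∀ x, ‖g x‖ ≤ B) :
    ∫⁻ x, ∫⁻ ξ, ENNReal.ofReal ((|x| + 2) ^ 2) * ‖gabor ψ g x ξ‖ₑ ^ 2
      ≤ ∫⁻ y, ENNReal.ofReal ((|y| + 3) ^ 2) * ‖𝓕 g y‖ₑ ^ 2 := by
  have hΦ : Measurable (𝓕 ψ) := (continuous_fourier hψi).measurable
  have hf : Measurable (𝓕 g) := (continuous_fourier hgi).measurable
  calc _ = ∫⁻ x, ∫⁻ y, ENNReal.ofReal ((|x| + 2) ^ 2) *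
          (‖𝓕 ψ (y - x)‖ₑ ^ 2 * ‖𝓕 g y‖ₑ ^ 2) := by
        refine lintegral_congr fun x => ?_
        rw [lintegral_const_mul' _ _ ENNReal.ofReal_ne_top, lintegral_gabor_sq_right hψi hgi hB,
          lintegral_const_mul' _ _ ENNReal.ofReal_ne_top]
    _ ≤ ∫⁻ x, ∫⁻ y, ENNReal.ofReal ((|y| + 3) ^ 2) * ‖𝓕 g y‖ₑ ^ 2 * ‖𝓕 ψ (y - x)‖ₑ ^ 2 := by
        refine lintegral_mono fun x => lintegral_mono fun y => ?_
        rcases lt_or_ge 1 |y - x| with h | h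
        · simp [hsupp _ h]
        rw [mul_comm (‖𝓕 ψ (y - x)‖ₑ ^ 2), ← mul_assoc]
        have h2 : |x| + 2 ≤ |y| + 3 := by
          have := abs_sub_abs_le_abs_sub x y
          rw [abs_sub_comm] at this
          linarith
        gcongr
    _ = ∫⁻ y, ∫⁻ x, ENNReal.ofReal ((|y| + 3) ^ 2) * ‖𝓕 g y‖ₑ ^ 2 * ‖𝓕 ψ (y - x)‖ₑ ^ 2 :=
        lintegral_lintegral_swap (Measurable.aemeasurable (by fun_prop))
    _ = _ := by
        refine lintegral_congr fun y => ?_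
        rw [lintegral_const_mul _ (by fun_prop),
          lintegral_sub_left_eq_self (fun x => ‖𝓕 ψ x‖ₑ ^ 2) y, hψ1, mul_one]

/-- The part of the energy controlled by the frequency. -/
theorem lintegral_gabor_frequency_le {m : ℝ} (hm : 1 ≤ m)
    (hψi : Integrable ψ) (hψc : Continuous ψ) {A : ℝ} (hA : ∀ x, ‖ψ x‖ ≤ A)
    (hψ1 : ∫⁻ ζ, ‖ψ ζ‖ₑ ^ 2 = 1)
    (hM : ∫⁻ ζ, ENNReal.ofReal (|ζ| ^ m) * ‖ψ ζ‖ₑ ^ 2 ≠ ⊤)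
    (hgi : Integrable g) (hgc : Continuous g) {B : ℝ} (hB : ∀ x, ‖g x‖ ≤ B) :
    ∫⁻ x, ∫⁻ ξ, ENNReal.ofReal (|ξ| ^ m) * ‖gabor ψ g x ξ‖ₑ ^ 2
      ≤ ∫⁻ η, ENNReal.ofReal
        ((|η| + (1 + (∫⁻ ζ, ENNReal.ofReal (|ζ| ^ m) * ‖ψ ζ‖ₑ ^ 2).toReal)) ^ m)
          * ‖g η‖ₑ ^ 2 := by
  have hV := measurable_gabor hψc hgc
  have hψm := hψc.measurable
  have hgm := hgc.measurable
  calc _ = ∫⁻ ξ, ∫⁻ x, ENNReal.ofReal (|ξ| ^ m) * ‖gabor ψ g x ξ‖ₑ ^ 2 := by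
        refine lintegral_lintegral_swap (Measurable.aemeasurable ?_)
        exact Measurable.mul (by fun_prop) (hV.enorm.pow_const 2)
    _ = ∫⁻ ξ, ∫⁻ ζ, ENNReal.ofReal (|ξ| ^ m) * (‖ψ ζ‖ₑ ^ 2 * ‖g (ξ - ζ)‖ₑ ^ 2) := by
        refine lintegral_congr fun ξ => ?_
        rw [lintegral_const_mul' _ _ ENNReal.ofReal_ne_top, lintegral_gabor_sq_left hψi hgi hA hB,
          lintegral_const_mul' _ _ ENNReal.ofReal_ne_top]
    _ = ∫⁻ ζ, ∫⁻ ξ, ENNReal.ofReal (|ξ| ^ m) * (‖ψ ζ‖ₑ ^ 2 * ‖g (ξ - ζ)‖ₑ ^ 2) :=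
        lintegral_lintegral_swap (Measurable.aemeasurable (by fun_prop))
    _ = ∫⁻ ζ, ∫⁻ η, ENNReal.ofReal (|η + ζ| ^ m) * (‖ψ ζ‖ₑ ^ 2 * ‖g η‖ₑ ^ 2) := by
        refine lintegral_congr fun ζ => ?_
        rw [← lintegral_add_right_eq_self _ ζ]
        simp only [add_sub_cancel_right]
    _ = ∫⁻ η, ∫⁻ ζ, ENNReal.ofReal (|η + ζ| ^ m) * (‖ψ ζ‖ₑ ^ 2 * ‖g η‖ₑ ^ 2) :=
        lintegral_lintegral_swap (Measurable.aemeasurable (by fun_prop))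
    _ = ∫⁻ η, (∫⁻ ζ, ENNReal.ofReal (|η + ζ| ^ m) * ‖ψ ζ‖ₑ ^ 2) * ‖g η‖ₑ ^ 2 := by
        refine lintegral_congr fun η => ?_
        rw [← lintegral_mul_const _ (by fun_prop)]
        simp only [mul_assoc]
    _ ≤ _ := by
        refine lintegral_mono fun η => ?_
        gcongr
        exact lintegral_add_rpow_le hm hψ1 hψm hM η

end Energy

/-- Let `0 < r ≤ 1`. There is a shift `C` such that `𝓕 g` vanishes identically when it has zeros
with gaps bounded by the weight of order `r`, and `g` satisfies the bound that Wirtinger's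
inequality yields for zeros of `g` with gaps bounded by the weight of order `1 / r`. -/
theorem exists_shift_energy {r : ℝ} (hr : 0 < r) (hr1 : r ≤ 1) :
    ∃ C : ℝ, 0 ≤ C ∧ ∀ g : ℝ → ℂ, Integrable g → Continuous g → (∃ B : ℝ, ∀ x, ‖g x‖ ≤ B) →
      ∀ Z : Set ℝ, IsGapBounded (fun y => (|y| + 3 ^ (1 / r)) ^ r) Z → (∀ y ∈ Z, 𝓕 g y = 0) →
      ∫⁻ y, ENNReal.ofReal ((|y| + 3) ^ 2) * ‖𝓕 g y‖ₑ ^ 2 ≠ ⊤ →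
      ∫⁻ ξ, ENNReal.ofReal (((|ξ| + C) ^ (1 / r)) ^ 2) * ‖g ξ‖ₑ ^ 2
        ≤ ∫⁻ y, ENNReal.ofReal (y ^ 2) * ‖𝓕 g y‖ₑ ^ 2 →
      ∀ y, 𝓕 g y = 0 := by
  obtain ⟨ψ, hsupp, hψ1⟩ := exists_window
  have hm : 1 ≤ 2 / r := by rw [le_div_iff₀ hr]; linarith
  have hM := lintegral_rpow_mul_schwartz_ne_top ψ (m := 2 / r) (by linarith)
  refine ⟨1 + (∫⁻ ζ, ENNReal.ofReal (|ζ| ^ (2 / r)) * ‖ψ ζ‖ₑ ^ 2).toReal, by positivity, ?_⟩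
  set C := 1 + (∫⁻ ζ, ENNReal.ofReal (|ζ| ^ (2 / r)) * ‖ψ ζ‖ₑ ^ 2).toReal with hC
  have hC0 : 0 ≤ C := by positivity
  rintro g hgi hgc ⟨B, hB⟩ Z hZ hz hS hfreq
  obtain ⟨A, -, hA⟩ := ψ.decay 0 0
  simp only [pow_zero, norm_iteratedFDeriv_zero, one_mul] at hA
  have hψF : ∫⁻ y, ‖𝓕 (ψ : ℝ → ℂ) y‖ₑ ^ 2 = 1 :=
    (lintegral_enorm_fourier_sq ψ.integrable (ψ.memLp 2 volume)).trans hψ1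
  have hV := measurable_gabor ψ.continuous hgc
  have hf : Measurable (𝓕 g) := (continuous_fourier hgi).measurable
  set S := ∫⁻ y, ENNReal.ofReal ((|y| + 3) ^ 2) * ‖𝓕 g y‖ₑ ^ 2
  set S' := ∫⁻ y, ENNReal.ofReal (y ^ 2) * ‖𝓕 g y‖ₑ ^ 2
  have hr1' : 0 ≤ 1 - r := by linarith
  have main : S ≤ ENNReal.ofReal (1 - r) * S + ENNReal.ofReal r * S' := by
    calc S ≤ _ := energy_le_lintegral_gabor hr hr1 ψ.integrable hψF hsupp hgi hZ hz
      _ ≤ ∫⁻ x, ∫⁻ ξ,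
          (ENNReal.ofReal (1 - r) * (ENNReal.ofReal ((|x| + 2) ^ 2) * ‖gabor ψ g x ξ‖ₑ ^ 2)
          + ENNReal.ofReal r * (ENNReal.ofReal (|ξ| ^ (2 / r)) * ‖gabor ψ g x ξ‖ₑ ^ 2)) := by
          refine lintegral_mono fun x => lintegral_mono fun ξ => ?_
          rw [← mul_assoc, ← mul_assoc, ← ENNReal.ofReal_mul hr1', ← ENNReal.ofReal_mul hr.le,
            ← add_mul, ← ENNReal.ofReal_add (by positivity) (by positivity)]
          gcongr
          exact young_symbol hr hr1 x ξ
      _ = ENNReal.ofReal (1 - r) *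
            (∫⁻ x, ∫⁻ ξ, ENNReal.ofReal ((|x| + 2) ^ 2) * ‖gabor ψ g x ξ‖ₑ ^ 2)
          + ENNReal.ofReal r *
            ∫⁻ x, ∫⁻ ξ, ENNReal.ofReal (|ξ| ^ (2 / r)) * ‖gabor ψ g x ξ‖ₑ ^ 2 := by
          exact lintegral_lintegral_linear
            (F := fun z => ENNReal.ofReal ((|z.1| + 2) ^ 2) * ‖gabor ψ g z.1 z.2‖ₑ ^ 2)
            (G := fun z => ENNReal.ofReal (|z.2| ^ (2 / r)) * ‖gabor ψ g z.1 z.2‖ₑ ^ 2)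
            (Measurable.mul (by fun_prop) (hV.enorm.pow_const 2))
            ENNReal.ofReal_ne_top ENNReal.ofReal_ne_top
      _ ≤ ENNReal.ofReal (1 - r) * S + ENNReal.ofReal r * S' := by
          gcongr
          · exact lintegral_gabor_position_le ψ.integrable hψF hsupp hgi hB
          · refine (lintegral_gabor_frequency_le hm ψ.integrable ψ.continuous hA hψ1 hM
              hgi hgc hB).trans (le_trans (lintegral_mono fun ξ => le_of_eq ?_) hfreq)
            rw [← Real.rpow_mul_natCast (by positivity)]
            congr 3
            push_cast
            ring
  -- The energies with weights `(|y| + 3)²` and `y²` differ by at least nine times the `L²` norm,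
  -- so finiteness of `S` forces that norm to vanish.
  have hSS : S + ENNReal.ofReal r * (9 * ∫⁻ y, ‖𝓕 g y‖ₑ ^ 2) ≤ S := by
    have h1 : S' + 9 * (∫⁻ y, ‖𝓕 g y‖ₑ ^ 2) ≤ S := by
      rw [← lintegral_const_mul' _ _ (by norm_num), ← lintegral_add_left (by fun_prop)]
      refine lintegral_mono fun y => ?_
      rw [← add_mul, show (9 : ENNReal) = ENNReal.ofReal 9 by simp,
        ← ENNReal.ofReal_add (by positivity) (by norm_num)]
      gcongr
      nlinarith [abs_nonneg y, sq_abs y]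
    calc _ ≤ ENNReal.ofReal (1 - r) * S + ENNReal.ofReal r * S'
          + ENNReal.ofReal r * (9 * ∫⁻ y, ‖𝓕 g y‖ₑ ^ 2) := by gcongr
      _ = ENNReal.ofReal (1 - r) * S
          + ENNReal.ofReal r * (S' + 9 * ∫⁻ y, ‖𝓕 g y‖ₑ ^ 2) := by ring
      _ ≤ ENNReal.ofReal (1 - r) * S + ENNReal.ofReal r * S := by gcongr
      _ = S := by
        rw [← add_mul, ← ENNReal.ofReal_add hr1' hr.le]
        simp
  have h0 : ENNReal.ofReal r * (9 * ∫⁻ y, ‖𝓕 g y‖ₑ ^ 2) = 0 := by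
    exact nonpos_iff_eq_zero.1 ((ENNReal.add_le_add_iff_left hS).1 (by simpa using hSS))
  have h2 : ∫⁻ y, ‖𝓕 g y‖ₑ ^ 2 = 0 := by
    simpa [ENNReal.ofReal_eq_zero, not_le.2 hr] using h0
  rw [lintegral_eq_zero_iff (by fun_prop)] at h2
  have h3 : 𝓕 g =ᵐ[volume] fun _ => 0 := by
    filter_upwards [h2] with y hy
    simpa using hy
  exact congrFun ((continuous_fourier hgi).ae_eq_iff_eq volume continuous_const |>.1 h3)

/-! ### Uniqueness -/

theorem integrable_of_integrable_weight {f : ℝ → ℂ} (hf : Continuous f)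
    (h : Integrable fun x : ℝ => (1 + x ^ 2) * ‖f x‖ ^ 2) : Integrable f := by
  refine (h.add integrable_inv_one_add_sq).mono' hf.aestronglyMeasurable
    (Eventually.of_forall fun x => ?_)
  have hw : (0 : ℝ) < 1 + x ^ 2 := by positivity
  have key : (1 + x ^ 2) * ‖f x‖ ^ 2 + (1 + x ^ 2)⁻¹ - ‖f x‖
      = (1 + x ^ 2) * (‖f x‖ - (1 + x ^ 2)⁻¹) ^ 2 + ‖f x‖ := by
    field_simp
    ring
  have : 0 ≤ (1 + x ^ 2) * (‖f x‖ - (1 + x ^ 2)⁻¹) ^ 2 + ‖f x‖ := by positivity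
  simp only [Pi.add_apply]
  linarith

theorem lintegral_weight_ne_top {f : ℝ → ℂ}
    (h : Integrable fun x : ℝ => (1 + x ^ 2) * ‖f x‖ ^ 2) :
    ∫⁻ y, ENNReal.ofReal ((|y| + 3) ^ 2) * ‖f y‖ₑ ^ 2 ≠ ⊤ := by
  refine ne_top_of_le_ne_top (h.const_mul 18).hasFiniteIntegral.ne (lintegral_mono fun y => ?_)
  beta_reduce
  rw [← ofReal_norm, ← ofReal_norm, ← ENNReal.ofReal_pow (norm_nonneg _),
    ← ENNReal.ofReal_mul (by positivity), Real.norm_of_nonneg (by positivity), ← mul_assoc]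
  gcongr
  -- `(|y| + 3)² ≤ 2 y² + 18`
  nlinarith [sq_abs y, sq_nonneg (|y| - 3)]

/-- Fourier inversion on the symmetric Sobolev space, written with the forward transform. -/
theorem fourier_fourier_comp_neg {f : ℝ → ℂ} (hf : f ∈ symSobolev) :
    𝓕 (fun ξ => 𝓕 f (-ξ)) = f := by
  have hfi := integrable_of_mem_symSobolev hf
  rw [← Real.fourierInv_eq_fourier_comp_neg]
  exact hf.1.fourierInv_fourier_eq hfi
    (integrable_of_integrable_weight (continuous_fourier hfi) hf.2.2.2)

/-- The bound at the left endpoint of each gap gives the bound at every point of the gap, once the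
shift is reduced by `1`, which exceeds the length of any gap. -/
theorem UniformGapBound.isGapBounded {p d : ℝ} {s : ℤ → ℝ} (h : UniformGapBound p (d + 1) s)
    (hp : 1 < p) (hd : 0 ≤ d) (hs : IsOrderedSeq s) :
    IsGapBounded (fun y => (|y| + d) ^ (p - 1)) (Set.range s) := by
  refine ⟨s, hs, fun j => Set.mem_range_self j, fun j y hy => ?_⟩
  have hL : 0 < s (j + 1) - s j := sub_pos.2 (hs.1 (lt_add_one j))
  have h1 : s (j + 1) - s j ≤ 1 / 2 := by
    refine le_trans ?_ (h j)
    exact le_mul_of_one_le_left hL.le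
      (Real.one_le_rpow (by linarith [abs_nonneg (s j)]) (by linarith))
  have h2 : |y| ≤ |s j| + 1 := by
    have h3 := abs_sub_abs_le_abs_sub y (s j)
    rw [abs_of_nonneg (sub_nonneg.2 hy.1)] at h3
    linarith [hy.2]
  refine le_trans (mul_le_mul_of_nonneg_right ?_ hL.le) (h j)
  exact Real.rpow_le_rpow (by positivity) (by linarith) (by linarith)

/-- For `r ≤ 1` there are shifts for which zeros of `f` in gaps of order `r` and zeros of `𝓕 f` in
gaps of order `1 / r`, or the same with the two roles exchanged, force `f = 0`. -/
theorem exists_shift_eq_zero {r : ℝ} (hr : 0 < r) (hr1 : r ≤ 1) :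
    ∃ C : ℝ, 0 ≤ C ∧ ∀ f ∈ symSobolev, ∀ Z Z' : Set ℝ,
      IsGapBounded (fun y => (|y| + 3 ^ (1 / r)) ^ r) Z →
      IsGapBounded (fun y => (|y| + C) ^ (1 / r)) Z' →
      ((∀ y ∈ Z, f y = 0) → (∀ y ∈ Z', 𝓕 f y = 0) → ∀ x, f x = 0) ∧
      ((∀ y ∈ Z, 𝓕 f y = 0) → (∀ y ∈ Z', f y = 0) → ∀ x, f x = 0) := by
  obtain ⟨C, hC, h⟩ := exists_shift_energy hr hr1
  refine ⟨C, hC, fun f hf Z Z' hZ hZ' => ?_⟩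
  have hfi := integrable_of_mem_symSobolev hf
  have hFc : Continuous (𝓕 f) := continuous_fourier hfi
  have hFi : Integrable (𝓕 f) := integrable_of_integrable_weight hFc hf.2.2.2
  have hgi : Integrable fun ξ => 𝓕 f (-ξ) := hFi.comp_neg
  have hinv := fourier_fourier_comp_neg hf
  constructor
  -- Here `f = 𝓕 g` with `g = 𝓕 f (- ·)`, and the energy argument is applied to `g`.
  · intro hz hz'
    have h1 := h (fun ξ => 𝓕 f (-ξ)) hgi (hFc.comp continuous_neg)
      ⟨_, fun x => norm_fourier_le (-x)⟩ Z hZ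
    rw [hinv] at h1
    refine h1 hz (lintegral_weight_ne_top hf.2.2.1) ?_
    refine le_trans (le_of_eq ?_) (wirtinger_fourier hfi (fun y => by positivity) hZ' hz')
    rw [← lintegral_neg_eq_self]
    simp only [neg_neg, abs_neg]
  -- With the roles exchanged it is applied to `f`, whose frequency bound comes from `f = 𝓕 g`.
  · intro hz hz'
    have hb : ∀ x, ‖f x‖ ≤ ∫ ξ, ‖𝓕 f (-ξ)‖ := fun x => by
      have h1 := norm_fourier_le (g := fun ξ => 𝓕 f (-ξ)) x
      rwa [hinv] at h1
    have hz2 : ∀ y ∈ Z', 𝓕 (fun ξ => 𝓕 f (-ξ)) y = 0 := by rwa [hinv]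
    have h2 := wirtinger_fourier hgi (fun y => by positivity) hZ' hz2
    rw [hinv, ← lintegral_neg_eq_self (fun ξ : ℝ => ENNReal.ofReal (ξ ^ 2) * ‖𝓕 f (-ξ)‖ₑ ^ 2)] at h2
    simp only [neg_neg, neg_sq] at h2
    have h3 := h f hfi hf.1 ⟨_, hb⟩ Z hZ hz (lintegral_weight_ne_top hf.2.2.2) h2
    intro x
    rw [← hinv]
    simp [h3, Real.fourier_real_eq]

/-- Existence of the shifts for conjugate exponents. The exponent that does not exceed `2` takes
the role of `r + 1` in `exists_shift_eq_zero`. -/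
theorem exists_shift_isUniquenessPair {p q : ℝ} (hp : 1 < p) (hq : 1 < q)
    (hpq : 1 / p + 1 / q = 1) :
    ∃ dp dq : ℝ, 0 ≤ dp ∧ 0 ≤ dq ∧ ∀ lam mu : ℤ → ℝ, IsOrderedSeq lam → IsOrderedSeq mu →
      UniformGapBound p dp lam → UniformGapBound q dq mu →
      IsUniquenessPair symSobolev (Set.range lam) (Set.range mu) := by
  have hprod : (p - 1) * (q - 1) = 1 := by
    field_simp at hpq
    linarith
  rcases le_total p 2 with h2 | h2
  · have hr : 0 < p - 1 := by linarith
    obtain ⟨C, hC, h⟩ := exists_shift_eq_zero hr (by linarith)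
    have e : q - 1 = 1 / (p - 1) := by
      rw [eq_div_iff hr.ne']
      linarith
    have hD : (0 : ℝ) ≤ 3 ^ (1 / (p - 1)) := by positivity
    refine ⟨3 ^ (1 / (p - 1)) + 1, C + 1, by linarith, by linarith, ?_⟩
    intro lam mu hl hm hgl hgm f hf
    have hm' := hgm.isGapBounded hq hC hm
    rw [e] at hm'
    exact (h f hf _ _ (hgl.isGapBounded hp hD hl) hm').1
  · have hr : 0 < q - 1 := by linarith
    have hr1 : q - 1 ≤ 1 := by nlinarith
    obtain ⟨C, hC, h⟩ := exists_shift_eq_zero hr hr1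
    have e : p - 1 = 1 / (q - 1) := by
      rw [eq_div_iff hr.ne']
      linarith
    have hD : (0 : ℝ) ≤ 3 ^ (1 / (q - 1)) := by positivity
    refine ⟨C + 1, 3 ^ (1 / (q - 1)) + 1, by linarith, by linarith, ?_⟩
    intro lam mu hl hm hgl hgm f hf hz hz'
    have hl' := hgl.isGapBounded hp hC hl
    rw [e] at hl'
    exact (h f hf _ _ (hgm.isGapBounded hq hD hm) hl').2 hz' hz

/-! ### Sequences of critical density -/

/-- The nonnegative half of a sequence of critical density: `a₀ = 0` and
`a_{n+1} = a_n + (a_n + c)^(-r) / 2`. -/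
noncomputable def criticalNat (r c : ℝ) : ℕ → ℝ
  | 0 => 0
  | n + 1 => criticalNat r c n + 1 / 2 * (criticalNat r c n + c) ^ (-r)

/-- The odd extension of `criticalNat` to the integers. -/
noncomputable def criticalInt (r c : ℝ) : ℤ → ℝ
  | .ofNat n => criticalNat r c n
  | .negSucc n => -criticalNat r c (n + 1)

section Critical

variable {r c : ℝ}

theorem criticalNat_succ (n : ℕ) : criticalNat r c (n + 1)
    = criticalNat r c n + 1 / 2 * (criticalNat r c n + c) ^ (-r) := rfl

theorem criticalNat_nonneg (hc : 0 ≤ c) (n : ℕ) : 0 ≤ criticalNat r c n := by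
  induction n with
  | zero => exact le_rfl
  | succ n ih => rw [criticalNat_succ]; positivity

theorem criticalNat_lt_succ (hc : 0 < c) (n : ℕ) :
    criticalNat r c n < criticalNat r c (n + 1) := by
  have := criticalNat_nonneg (r := r) hc.le n
  rw [criticalNat_succ]
  exact lt_add_of_pos_right _ (by positivity)

theorem criticalNat_succ_le (hr : 0 ≤ r) (hc : 1 ≤ c) (n : ℕ) :
    criticalNat r c (n + 1) ≤ criticalNat r c n + 1 := by
  have h := criticalNat_nonneg (r := r) (zero_le_one.trans hc) n
  have h1 : (criticalNat r c n + c) ^ (-r) ≤ 1 :=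
    Real.rpow_le_one_of_one_le_of_nonpos (by linarith) (by linarith)
  rw [criticalNat_succ]
  linarith

theorem tendsto_criticalNat (hc : 0 < c) : Tendsto (criticalNat r c) atTop atTop := by
  have hm : StrictMono (criticalNat r c) := strictMono_nat_of_lt_succ (criticalNat_lt_succ hc)
  rcases tendsto_atTop_of_monotone hm.monotone with h | ⟨l, hl⟩
  · exact h
  exfalso
  have hl0 : 0 ≤ l := ge_of_tendsto' hl (criticalNat_nonneg hc.le)
  have h1 := hl.comp (tendsto_add_atTop_nat 1)
  have h2 : Tendsto (fun n => criticalNat r c n + 1 / 2 * (criticalNat r c n + c) ^ (-r)) atTop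
      (𝓝 (l + 1 / 2 * (l + c) ^ (-r))) :=
    hl.add (((hl.add_const c).rpow_const (Or.inl (by positivity))).const_mul _)
  have h3 := tendsto_nhds_unique h1 h2
  have h4 : 0 < (l + c) ^ (-r) := by positivity
  linarith

theorem criticalInt_negSucc (n : ℕ) :
    criticalInt r c (Int.negSucc n) = -criticalNat r c (n + 1) := rfl

theorem criticalInt_negSucc_add_one (n : ℕ) :
    criticalInt r c (Int.negSucc n + 1) = -criticalNat r c n := by
  cases n with
  | zero => exact neg_zero.symm
  | succ n => rfl

theorem isOrderedSeq_criticalInt (hc : 0 < c) : IsOrderedSeq (criticalInt r c) := by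
  have hm : StrictMono (criticalInt r c) := by
    refine strictMono_int_of_lt_succ fun j => ?_
    cases j with
    | ofNat n => exact criticalNat_lt_succ hc n
    | negSucc n =>
      rw [criticalInt_negSucc_add_one, criticalInt_negSucc]
      exact neg_lt_neg (criticalNat_lt_succ hc n)
  refine ⟨hm, tendsto_atTop_atTop_of_monotone hm.monotone fun b => ?_,
    tendsto_atBot_atBot_of_monotone hm.monotone fun b => ?_⟩
  · obtain ⟨n, hn⟩ := ((tendsto_criticalNat (r := r) hc).eventually_ge_atTop b).exists
    exact ⟨n, hn⟩
  · obtain ⟨n, hn⟩ := ((tendsto_criticalNat (r := r) hc).eventually_ge_atTop (-b)).exists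
    refine ⟨Int.negSucc n, ?_⟩
    rw [criticalInt_negSucc]
    linarith [criticalNat_lt_succ (r := r) hc n]

/-- Each gap is half the power `-r` of a number between `|s_j| + c - 1` and `|s_j| + c`. -/
theorem exists_criticalInt_gap (hr : 0 ≤ r) (hc : 1 ≤ c) (j : ℤ) :
    ∃ t, |criticalInt r c j| + (c - 1) ≤ t ∧ t ≤ |criticalInt r c j| + c ∧ 0 < t ∧
      criticalInt r c (j + 1) - criticalInt r c j = 1 / 2 * t ^ (-r) := by
  have hc0 : 0 < c := by linarith
  cases j with
  | ofNat n =>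
    have h := criticalNat_nonneg (r := r) hc0.le n
    have e : criticalInt r c (Int.ofNat n) = criticalNat r c n := rfl
    have e1 : criticalInt r c (Int.ofNat n + 1) = criticalNat r c (n + 1) := rfl
    rw [e, e1, abs_of_nonneg h]
    exact ⟨criticalNat r c n + c, by linarith, le_rfl, by linarith, by rw [criticalNat_succ]; ring⟩
  | negSucc n =>
    have h := criticalNat_nonneg (r := r) hc0.le n
    have h1 := criticalNat_lt_succ (r := r) hc0 n
    have h2 := criticalNat_succ_le hr hc n
    rw [criticalInt_negSucc_add_one, criticalInt_negSucc, abs_neg, abs_of_nonneg (h.trans h1.le)]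
    exact ⟨criticalNat r c n + c, by linarith, by linarith, by linarith,
      by rw [criticalNat_succ]; ring⟩

theorem uniformGapBound_criticalInt {p d : ℝ} (hp : 1 < p) (hd : 0 ≤ d) :
    UniformGapBound p d (criticalInt (p - 1) (d + 1)) := by
  intro j
  obtain ⟨t, h1, -, ht, hgap⟩ := exists_criticalInt_gap (r := p - 1) (c := d + 1)
    (by linarith) (by linarith) j
  rw [hgap, Real.rpow_neg ht.le]
  have h3 : (|criticalInt (p - 1) (d + 1) j| + d) ^ (p - 1) ≤ t ^ (p - 1) :=
    Real.rpow_le_rpow (by positivity) (by linarith) (by linarith)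
  have h4 : 0 < t ^ (p - 1) := by positivity
  calc _ ≤ t ^ (p - 1) * (1 / 2 * (t ^ (p - 1))⁻¹) := by gcongr
    _ = 1 / 2 := by field_simp

theorem hasCriticalDensity_criticalInt {p d : ℝ} (hp : 1 < p) (hd : 0 ≤ d) :
    HasCriticalDensity p (criticalInt (p - 1) (d + 1)) := by
  have hs := isOrderedSeq_criticalInt (r := p - 1) (c := d + 1) (by linarith)
  have habs : Tendsto (fun j => |criticalInt (p - 1) (d + 1) j|) cofinite atTop := by
    rw [Int.cofinite_eq]
    exact (tendsto_abs_atBot_atTop.comp hs.2.2).sup (tendsto_abs_atTop_atTop.comp hs.2.1)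
  have hφ : Tendsto (fun t : ℝ => 1 / 2 * (1 - (d + 1) / (t + (d + 1))) ^ (p - 1)) atTop
      (𝓝 (1 / 2)) := by
    have h1 : Tendsto (fun t : ℝ => 1 - (d + 1) / (t + (d + 1))) atTop (𝓝 (1 - 0)) :=
      tendsto_const_nhds.sub
        (tendsto_const_nhds.div_atTop (tendsto_atTop_add_const_right _ _ tendsto_id))
    have h2 := (h1.rpow_const (p := p - 1) (Or.inl (by norm_num))).const_mul (1 / 2)
    simpa using h2
  refine tendsto_of_tendsto_of_tendsto_of_le_of_le (hφ.comp habs) tendsto_const_nhds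
    (fun j => ?_) (fun j => ?_)
  · obtain ⟨t, -, h2, ht, hgap⟩ := exists_criticalInt_gap (r := p - 1) (c := d + 1)
      (by linarith) (by linarith) j
    simp only [Function.comp_apply]
    rw [hgap, Real.rpow_neg ht.le]
    set b := |criticalInt (p - 1) (d + 1) j| with hb
    have hb0 : 0 ≤ b := abs_nonneg _
    have e : 1 - (d + 1) / (b + (d + 1)) = b / (b + (d + 1)) := by
      field_simp
      ring
    rw [e, Real.div_rpow hb0 (by positivity)]
    have h3 : t ^ (p - 1) ≤ (b + (d + 1)) ^ (p - 1) :=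
      Real.rpow_le_rpow ht.le h2 (by linarith)
    have h4 : 0 < t ^ (p - 1) := by positivity
    calc 1 / 2 * (b ^ (p - 1) / (b + (d + 1)) ^ (p - 1))
        ≤ 1 / 2 * (b ^ (p - 1) / t ^ (p - 1)) := by gcongr
      _ = b ^ (p - 1) * (1 / 2 * (t ^ (p - 1))⁻¹) := by ring
  · refine le_trans (mul_le_mul_of_nonneg_right ?_ (sub_nonneg.2 (hs.1 (lt_add_one j)).le))
      (uniformGapBound_criticalInt hp hd j)
    exact Real.rpow_le_rpow (abs_nonneg _) (by linarith) (by linarith)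

end Critical

end FourierUniqueness

theorem mainTheorem3 (p q : ℝ) (hp : 1 < p) (hq : 1 < q) (hpq : 1 / p + 1 / q = 1) :
    ∃ dp dq : ℝ, 0 ≤ dp ∧ 0 ≤ dq ∧
      (∀ lam mu : ℤ → ℝ,
        FourierUniqueness.IsOrderedSeq lam → FourierUniqueness.IsOrderedSeq mu →
        FourierUniqueness.UniformGapBound p dp lam →
        FourierUniqueness.UniformGapBound q dq mu →
        FourierUniqueness.IsUniquenessPair FourierUniqueness.symSobolev
          (Set.range lam) (Set.range mu)) ∧
      (∃ lam mu : ℤ → ℝ,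
        FourierUniqueness.IsOrderedSeq lam ∧ FourierUniqueness.IsOrderedSeq mu ∧
        FourierUniqueness.UniformGapBound p dp lam ∧
        FourierUniqueness.UniformGapBound q dq mu ∧
        FourierUniqueness.HasCriticalDensity p lam ∧
        FourierUniqueness.HasCriticalDensity q mu ∧
        FourierUniqueness.IsUniquenessPair FourierUniqueness.symSobolev
          (Set.range lam) (Set.range mu)) := by
  obtain ⟨dp, dq, hdp, hdq, h⟩ :=
    FourierUniqueness.exists_shift_isUniquenessPair hp hq hpq
  have hl := FourierUniqueness.isOrderedSeq_criticalInt (r := p - 1) (c := dp + 1) (by linarith)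
  have hm := FourierUniqueness.isOrderedSeq_criticalInt (r := q - 1) (c := dq + 1) (by linarith)
  have hgl := FourierUniqueness.uniformGapBound_criticalInt hp hdp
  have hgm := FourierUniqueness.uniformGapBound_criticalInt hq hdq
  exact ⟨dp, dq, hdp, hdq, h, _, _, hl, hm, hgl, hgm,
    FourierUniqueness.hasCriticalDensity_criticalInt hp hdp,
    FourierUniqueness.hasCriticalDensity_criticalInt hq hdq, h _ _ hl hm hgl hgm⟩
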